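/- A Kripke frame is a pair $(P,R)$ of a set $P$ and a binary relation $R$ on $P$. A p-morphism $f:(P,R)\to(Q,S)$ is a function $f:P\to Q$ such that $pRp'$ implies $f(p)\,S\,f(p')$, and such that whenever $f(p)\,S\,q'$ there is $p'\in P$ with $pRp'$ and $f(p')=q'$. Let $\mathbf{KFr}$ be the category of Kripke frames and p-morphisms. A frame $(P,R)$ is locally finite if for every $p\in P$ the set $R^*(p)=\{q\in P: p\,R^*\,q\}$ is finite, where $R^*$ is the reflexive-transitive closure of $R$. Let $\mathbf{KFr}_{lf}$ and $\mathbf{KFr}_f$ be the full subcategories of $\mathbf{KFr}$ of locally finite frames and of finite frames, respectively. For an essentially small category $\mathcal C$, let $\mathrm{Ind}\text{-}\mathcal C$ be the full subcategory of $\mathbf{Set}^{\mathcal C^{op}}$ of small filtered colimits of representable functors. **Theorem.** The category $\mathbf{KFr}_f$ is essentially small, and $\mathbf{KFr}_{lf}$ is its Ind-completion: there is an equivalence of categories $\mathrm{Ind}\text{-}\mathbf{KFr}_f\simeq\mathbf{KFr}_{lf}$ whose composite with the Yoneda embedding $\mathbf{KFr}_f\to\mathrm{Ind}\text{-}\mathbf{KFr}_f$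 is naturally isomorphic to the inclusion $\mathbf{KFr}_f\hookrightarrow\mathbf{KFr}_{lf}$. The category $\mathbf{KFr}_{lf}$ has small filtered colimits, and every finite frame $P$ is finitely presentable in $\mathbf{KFr}_{lf}$, i.e. $\mathrm{Hom}_{\mathbf{KFr}_{lf}}(P,-):\mathbf{KFr}_{lf}\to\mathbf{Set}$ preserves small filtered colimits. Moreover, $\mathbf{KFr}_{lf}$ coincides with the full subcategory of $\mathbf{KFr}$ of those frames that are colimits in $\mathbf{KFr}$ of small filtered diagrams of finite frames: a Kripke frame is locally finite if and only if it is such a colimit. -/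

import Mathlib

open CategoryTheory CategoryTheory.Limits

universe u

/-- A Kripke frame: a set together with a binary relation on it. -/
structure KFr : Type (u + 1) where
  carrier : Type u
  rel : carrier → carrier → Prop

namespace KFr

/-- A p-morphism of Kripke frames: a stable and open function. -/
@[ext]
structure Hom (P Q : KFr.{u}) : Type u where
  toFun : P.carrier → Q.carrier
  stable : ∀ p p' : P.carrier, P.rel p p' → Q.rel (toFun p) (toFun p')
  isOpen : ∀ (q' : Q.carrier) (p : P.carrier), Q.rel (toFun p) q' →
    ∃ p' : P.carrier, P.rel p p' ∧ toFun p' = q'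

/-- The identity p-morphism. -/
def Hom.id (P : KFr.{u}) : Hom P P where
  toFun p := p
  stable _ _ h := h
  isOpen q' _ h := ⟨q', h, rfl⟩

/-- Composition of p-morphisms. -/
def Hom.comp {P Q S : KFr.{u}} (f : Hom P Q) (g : Hom Q S) : Hom P S where
  toFun p := g.toFun (f.toFun p)
  stable p p' h := g.stable _ _ (f.stable p p' h)
  isOpen s' p h := by
    obtain ⟨q', hq, rfl⟩ := g.isOpen s' (f.toFun p) h
    obtain ⟨p', hp, rfl⟩ := f.isOpen q' p hq
    exact ⟨p', hp, rfl⟩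

/-- The category of Kripke frames and p-morphisms. -/
instance : Category.{u} KFr.{u} where
  Hom P Q := Hom P Q
  id P := Hom.id P
  comp f g := Hom.comp f g

/-- The set `R*(p)` of points reachable from `p` through the reflexive-transitive closure
of the relation. -/
def reachable (P : KFr.{u}) (p : P.carrier) : Set P.carrier :=
  {q | Relation.ReflTransGen P.rel p q}

/-- Finite Kripke frames. -/
def isFinite : ObjectProperty KFr.{u} := fun P => Finite P.carrier

/-- Locally finite Kripke frames: `R*(p)` is finite for every point `p`. -/
def isLocallyFinite : ObjectProperty KFr.{u} := fun P => ∀ p : P.carrier, (P.reachable p).Finite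

theorem isFinite_le_isLocallyFinite : isFinite.{u} ≤ isLocallyFinite.{u} := fun P hP _ =>
  haveI : Finite P.carrier := hP
  Set.toFinite _

end KFr

/-- The full subcategory of `KFr` on the finite Kripke frames. -/
abbrev KFrF : Type (u + 1) := KFr.isFinite.{u}.FullSubcategory

/-- The full subcategory of `KFr` on the locally finite Kripke frames. -/
abbrev KFrLF : Type (u + 1) := KFr.isLocallyFinite.{u}.FullSubcategory

/-- The inclusion of finite Kripke frames into locally finite ones. -/
abbrev KFrF.toLF : KFrF.{u} ⥤ KFrLF.{u} :=
  ObjectProperty.ιOfLE KFr.isFinite_le_isLocallyFinite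

/-- The Kripke frames which are a colimit, taken in `KFr`, of a small filtered diagram of finite
Kripke frames. -/
def KFr.isFilteredColimitOfFinite : ObjectProperty KFr.{u} := fun P =>
  ∃ (J : Type u) (_ : SmallCategory J) (_ : IsFiltered J) (F : J ⥤ KFrF.{u})
    (c : Cocone (F ⋙ KFr.isFinite.ι)), c.pt = P ∧ Nonempty (IsColimit c)

/-! Filtered colimits in `KFr` are computed on underlying sets: points merged in the colimit are
already merged at some stage, and openness of the transition maps pulls successors back. A
p-morphism maps $R^*(p)$ onto $R^*(f(p))$, so local finiteness passes to these colimits. Conversely,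
a locally finite frame is the directed union of its finite upward closed subframes. A map from a
finite frame into such a colimit lifts pointwise to a stage; local finiteness leaves only finitely
many identifications to enforce before the lift is a p-morphism (`exists_comp_eq`). So finite frames
are finitely presentable and generate under filtered colimits, and the general criterion
`exists_ind_equivalence` identifies the Ind-completion. -/

namespace KFr

@[simp]
theorem comp_toFun {P Q S : KFr.{u}} (f : P ⟶ Q) (g : Q ⟶ S) (x : P.carrier) :
    Hom.toFun (f ≫ g) x = Hom.toFun g (Hom.toFun f x) :=
  rfl

theorem hom_ext {P Q : KFr.{u}} {f g : P ⟶ Q} (h : ∀ x, Hom.toFun f x = Hom.toFun g x) : f = g :=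
  Hom.ext (funext h)

/-- The underlying set functor on Kripke frames. -/
def forget : KFr.{u} ⥤ Type u where
  obj P := P.carrier
  map f := ↾(Hom.toFun f)

theorem reachable_closed {P : KFr.{u}} {p q r : P.carrier} (hq : q ∈ P.reachable p)
    (h : P.rel q r) : r ∈ P.reachable p :=
  Relation.ReflTransGen.tail hq h

/-- The points reachable from `f p` are the images of the points reachable from `p`. -/
theorem reachable_map {P Q : KFr.{u}} (f : P ⟶ Q) (p : P.carrier) :
    Q.reachable (Hom.toFun f p) = Hom.toFun f '' P.reachable p := by
  ext q
  constructor
  · intro h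
    induction h with
    | refl => exact ⟨p, Relation.ReflTransGen.refl, rfl⟩
    | tail _ hr ih =>
      obtain ⟨x, hx, rfl⟩ := ih
      obtain ⟨y, hy, rfl⟩ := Hom.isOpen f _ _ hr
      exact ⟨y, reachable_closed hx hy, rfl⟩
  · rintro ⟨x, hx, rfl⟩
    exact Relation.ReflTransGen.lift (f := Hom.toFun f) (Hom.stable f) _ _ hx

/-! ### Filtered colimits of frames -/

section FilteredColimit

variable {J : Type u} [SmallCategory J] (F : J ⥤ KFr.{u})

theorem cocone_w (c : Cocone F) {i j : J} (f : i ⟶ j) (x : (F.obj i).carrier) :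
    Hom.toFun (c.ι.app j) (Hom.toFun (F.map f) x) = Hom.toFun (c.ι.app i) x :=
  congrArg (fun g : F.obj i ⟶ c.pt => Hom.toFun g x) (c.w f)

theorem map_comp_toFun {i j k : J} (f : i ⟶ j) (g : j ⟶ k) (x : (F.obj i).carrier) :
    Hom.toFun (F.map (f ≫ g)) x = Hom.toFun (F.map g) (Hom.toFun (F.map f) x) := by
  rw [F.map_comp, comp_toFun]

/-- The inclusions into the colimit of the underlying sets. -/
noncomputable def colimitι (j : J) (x : (F.obj j).carrier) : colimit (F ⋙ forget) :=
  colimit.ι (F ⋙ forget) j x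

theorem colimitι_surjective (x : colimit (F ⋙ forget)) : ∃ j y, colimitι F j y = x :=
  Types.jointly_surjective' (F := F ⋙ forget) x

theorem colimitι_map {i j : J} (f : i ⟶ j) (x : (F.obj i).carrier) :
    colimitι F j (Hom.toFun (F.map f) x) = colimitι F i x :=
  ConcreteCategory.congr_hom (colimit.w (F ⋙ forget) f) x

/-- The function out of the colimit of the underlying sets induced by a cocone. -/
noncomputable def colimitDesc (s : Cocone F) (x : colimit (F ⋙ forget)) : s.pt.carrier :=
  colimit.desc (F ⋙ forget) (forget.mapCocone s) x

theorem colimitDesc_ι (s : Cocone F) (j : J) (x : (F.obj j).carrier) :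
    colimitDesc F s (colimitι F j x) = Hom.toFun (s.ι.app j) x :=
  ConcreteCategory.congr_hom (colimit.ι_desc (forget.mapCocone s) j) x

variable [IsFiltered J]

theorem colimitι_eq_iff {i j : J} (x : (F.obj i).carrier) (y : (F.obj j).carrier) :
    colimitι F i x = colimitι F j y ↔
      ∃ (k : J) (f : i ⟶ k) (g : j ⟶ k), Hom.toFun (F.map f) x = Hom.toFun (F.map g) y :=
  Types.FilteredColimit.colimit_eq_iff (F ⋙ forget)

/-- The colimit of a filtered diagram of Kripke frames. -/
noncomputable def filteredColimit : KFr.{u} where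
  carrier := colimit (F ⋙ forget)
  rel a b := ∃ (j : J) (x y : (F.obj j).carrier),
    (F.obj j).rel x y ∧ colimitι F j x = a ∧ colimitι F j y = b

/-- The colimit cocone of a filtered diagram of Kripke frames. -/
noncomputable def filteredColimitCocone : Cocone F where
  pt := filteredColimit F
  ι :=
    { app j :=
        { toFun := colimitι F j
          stable x y h := ⟨j, x, y, h, rfl, rfl⟩
          isOpen := by
            rintro _ x ⟨k, x', y', h, hx, rfl⟩
            obtain ⟨m, f, g, e⟩ := (colimitι_eq_iff F _ _).1 hx
            -- The edge lives at stage `k`; push it to `m`, where its source agrees with the image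
            -- of `x`, then pull it back to `j` by openness of `F.map g`.
            have h' := Hom.stable (F.map f) _ _ h
            rw [e] at h'
            obtain ⟨y, hy, e'⟩ := Hom.isOpen (F.map g) _ _ h'
            exact ⟨y, hy, by rw [← colimitι_map F g, e', colimitι_map]⟩ }
      naturality i j f := hom_ext fun x => colimitι_map F f x }

/-- `filteredColimitCocone` is a colimit cocone. -/
noncomputable def filteredColimitCoconeIsColimit : IsColimit (filteredColimitCocone F) where
  desc s :=
    { toFun := colimitDesc F s
      stable := by
        rintro _ _ ⟨j, x, y, h, rfl, rfl⟩
        rw [colimitDesc_ι, colimitDesc_ι]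
        exact Hom.stable (s.ι.app j) _ _ h
      isOpen := by
        intro q' a h
        obtain ⟨j, x, rfl⟩ := colimitι_surjective F a
        rw [colimitDesc_ι] at h
        obtain ⟨y, hy, rfl⟩ := Hom.isOpen (s.ι.app j) _ _ h
        exact ⟨colimitι F j y, ⟨j, x, y, hy, rfl, rfl⟩, colimitDesc_ι F s j y⟩ }
  fac s j := hom_ext fun x => colimitDesc_ι F s j x
  uniq s m hm := hom_ext fun a => by
    obtain ⟨j, x, rfl⟩ := colimitι_surjective F a
    refine Eq.trans ?_ (colimitDesc_ι F s j x).symm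
    exact congrArg (fun g : F.obj j ⟶ s.pt => Hom.toFun g x) (hm j)

instance hasColimitsOfShape_of_isFiltered : HasColimitsOfShape J KFr.{u} where
  has_colimit F := ⟨_, filteredColimitCoconeIsColimit F⟩

instance forget_preservesColimitsOfShape : PreservesColimitsOfShape J forget.{u} where
  preservesColimit {F} :=
    preservesColimit_of_preserves_colimit_cocone (filteredColimitCoconeIsColimit F)
      (IsColimit.ofIsoColimit (colimit.isColimit (F ⋙ forget))
        (Cocone.ext (Iso.refl _) fun _ => rfl))

variable {F} {c : Cocone F}

theorem isColimit_surjective (hc : IsColimit c) (x : c.pt.carrier) :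
    ∃ (j : J) (y : (F.obj j).carrier), Hom.toFun (c.ι.app j) y = x :=
  Types.jointly_surjective_of_isColimit (isColimitOfPreserves forget hc) x

theorem isColimit_eq_iff (hc : IsColimit c) {i j : J} (x : (F.obj i).carrier) (y : (F.obj j).carrier) :
    Hom.toFun (c.ι.app i) x = Hom.toFun (c.ι.app j) y ↔
      ∃ (k : J) (f : i ⟶ k) (g : j ⟶ k), Hom.toFun (F.map f) x = Hom.toFun (F.map g) y :=
  Types.FilteredColimit.isColimit_eq_iff (F ⋙ forget) (isColimitOfPreserves forget hc)

theorem isColimit_isLocallyFinite (hc : IsColimit c) (hF : ∀ j, isLocallyFinite (F.obj j)) :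
    isLocallyFinite c.pt := by
  intro x
  obtain ⟨j, y, rfl⟩ := isColimit_surjective hc x
  have := reachable_map (c.ι.app j) y
  exact this ▸ (hF j y).image _

end FilteredColimit

instance isLocallyFinite_isClosedUnderColimitsOfShape (J : Type u) [SmallCategory J]
    [IsFiltered J] : isLocallyFinite.{u}.IsClosedUnderColimitsOfShape J where
  colimitsOfShape_le := by
    rintro X ⟨p⟩
    exact isColimit_isLocallyFinite p.isColimit p.prop_diag_obj

end KFr

instance KFrLF.hasFilteredColimits : HasFilteredColimits KFrLF.{u} where
  HasColimitsOfShape J _ _ := hasColimitsOfShape_of_closedUnderColimits J KFr.isLocallyFinite.{u}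

namespace KFr

/-! ### Finite frames are finitely presentable -/

section FinitelyPresentable

variable {J : Type u} [SmallCategory J] [IsFiltered J] {F : J ⥤ KFr.{u}} {c : Cocone F}

/-- A finite family of points of a filtered colimit lifts to some stage. -/
theorem exists_lift_of_finite (hc : IsColimit c) {α : Type u} [Finite α]
    (f : α → c.pt.carrier) :
    ∃ (j : J) (g : α → (F.obj j).carrier), ∀ a, Hom.toFun (c.ι.app j) (g a) = f a := by
  classical
  choose j y hy using fun a => isColimit_surjective hc (f a)
  have := Fintype.ofFinite α
  obtain ⟨k, hk⟩ := IsFiltered.sup_objs_exists (Finset.univ.image j)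
  have u (a : α) : j a ⟶ k := (hk (Finset.mem_image_of_mem j (Finset.mem_univ a))).some
  exact ⟨k, fun a => Hom.toFun (F.map (u a)) (y a), fun a => (cocone_w F c (u a) (y a)).trans (hy a)⟩

/-- Finitely many identifications made by a filtered colimit are made at some stage. -/
theorem exists_map_eq_of_finite (hc : IsColimit c) {α : Type u} [Finite α] {i : J}
    (x y : α → (F.obj i).carrier)
    (h : ∀ a, Hom.toFun (c.ι.app i) (x a) = Hom.toFun (c.ι.app i) (y a)) :
    ∃ (k : J) (u : i ⟶ k), ∀ a, Hom.toFun (F.map u) (x a) = Hom.toFun (F.map u) (y a) := by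
  classical
  have := Fintype.ofFinite α
  suffices H : ∀ s : Finset α, ∃ (k : J) (u : i ⟶ k), ∀ a ∈ s,
      Hom.toFun (F.map u) (x a) = Hom.toFun (F.map u) (y a) by
    obtain ⟨k, u, hu⟩ := H Finset.univ
    exact ⟨k, u, fun a => hu a (Finset.mem_univ a)⟩
  intro s
  induction s using Finset.induction_on with
  | empty => exact ⟨i, 𝟙 i, by simp⟩
  | insert a s _ ih =>
    obtain ⟨k, u, hu⟩ := ih
    -- The two points may be merged along different arrows `v` and `w`, so these are coequalized
    -- afterwards.
    obtain ⟨l, v, w, e⟩ := (isColimit_eq_iff hc (Hom.toFun (F.map u) (x a))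
      (Hom.toFun (F.map u) (y a))).1 (by rw [cocone_w, cocone_w, h])
    refine ⟨_, u ≫ v ≫ IsFiltered.coeqHom v w, fun b hb => ?_⟩
    obtain rfl | hb := Finset.mem_insert.1 hb
    · rw [map_comp_toFun, map_comp_toFun, map_comp_toFun, e, ← map_comp_toFun, ← map_comp_toFun,
        ← IsFiltered.coeq_condition, map_comp_toFun, map_comp_toFun]
    · rw [map_comp_toFun, hu b hb, ← map_comp_toFun]

/-- Some transition map identifies all points of a finite set which the colimit identifies. -/
theorem exists_map_eq_of_finite_set (hc : IsColimit c) {i : J} {S : Set (F.obj i).carrier}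
    (hS : S.Finite) :
    ∃ (k : J) (u : i ⟶ k), ∀ x ∈ S, ∀ y ∈ S,
      Hom.toFun (c.ι.app i) x = Hom.toFun (c.ι.app i) y →
        Hom.toFun (F.map u) x = Hom.toFun (F.map u) y := by
  have := hS.to_subtype
  obtain ⟨k, u, hu⟩ := exists_map_eq_of_finite hc
    (α := {a : S × S // Hom.toFun (c.ι.app i) a.1.1 = Hom.toFun (c.ι.app i) a.2.1})
    (fun a => a.1.1.1) (fun a => a.1.2.1) (fun a => a.2)
  exact ⟨k, u, fun x hx y hy h => hu ⟨(⟨x, hx⟩, ⟨y, hy⟩), h⟩⟩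

/-- p-morphisms from a finite frame which agree in a filtered colimit agree at some stage. -/
theorem exists_comp_map_eq (hc : IsColimit c) {P : KFr.{u}} [Finite P.carrier] {i : J}
    (f g : P ⟶ F.obj i) (h : f ≫ c.ι.app i = g ≫ c.ι.app i) :
    ∃ (k : J) (u : i ⟶ k), f ≫ F.map u = g ≫ F.map u := by
  obtain ⟨k, u, hu⟩ := exists_map_eq_of_finite hc (Hom.toFun f) (Hom.toFun g)
    fun p => congrArg (fun m : P ⟶ c.pt => Hom.toFun m p) h
  exact ⟨k, u, hom_ext hu⟩

/-- A p-morphism from a finite frame to a filtered colimit of locally finite frames factors through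
some stage. -/
theorem exists_comp_eq (hc : IsColimit c) (hF : ∀ j, isLocallyFinite (F.obj j)) {P : KFr.{u}}
    [Finite P.carrier] (f : P ⟶ c.pt) : ∃ (j : J) (g : P ⟶ F.obj j), g ≫ c.ι.app j = f := by
  obtain ⟨i, g, hg⟩ := exists_lift_of_finite hc (Hom.toFun f)
  -- `g` is only a lift of functions. Both p-morphism conditions compare some `g p'` with a
  -- successor of some `g p`; all these points lie in this finite set, so one arrow `u` settles
  -- every comparison.
  obtain ⟨k, u, hu⟩ := exists_map_eq_of_finite_set hc (S := ⋃ p, (F.obj i).reachable (g p))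
    (Set.finite_iUnion fun p => hF i (g p))
  have mem (p) : g p ∈ ⋃ p, (F.obj i).reachable (g p) :=
    Set.mem_iUnion.2 ⟨p, Relation.ReflTransGen.refl⟩
  have mem' (p y) (h : (F.obj i).rel (g p) y) : y ∈ ⋃ p, (F.obj i).reachable (g p) :=
    Set.mem_iUnion.2 ⟨p, Relation.ReflTransGen.single h⟩
  refine ⟨k, ⟨fun p => Hom.toFun (F.map u) (g p), fun p p' hp => ?_, fun q' p hq => ?_⟩,
    hom_ext fun p => (cocone_w F c u (g p)).trans (hg p)⟩
  · have h := Hom.stable f _ _ hp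
    rw [← hg p] at h
    obtain ⟨y, hy, e⟩ := Hom.isOpen (c.ι.app i) _ _ h
    rw [← hu y (mem' p y hy) (g p') (mem p') (e.trans (hg p').symm)]
    exact Hom.stable (F.map u) _ _ hy
  · obtain ⟨z, hz, rfl⟩ := Hom.isOpen (F.map u) _ _ hq
    have h : c.pt.rel _ _ := Hom.stable (c.ι.app i) _ _ hz
    rw [hg p] at h
    obtain ⟨p', hp', e⟩ := Hom.isOpen f _ _ h
    exact ⟨p', hp', hu _ (mem p') z (mem' p z hz) ((hg p').trans e)⟩

end FinitelyPresentable

/-! ### Locally finite frames as unions of finite upsets -/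

section FiniteUpset

/-- The finite subsets of a Kripke frame closed under the relation. -/
def FiniteUpset (P : KFr.{u}) : Type u :=
  {S : Set P.carrier // S.Finite ∧ ∀ x ∈ S, ∀ y, P.rel x y → y ∈ S}

variable (P : KFr.{u})

instance : PartialOrder P.FiniteUpset :=
  inferInstanceAs (PartialOrder (Subtype _))

instance : Nonempty P.FiniteUpset :=
  ⟨⟨∅, Set.finite_empty, by simp⟩⟩

instance : IsDirectedOrder P.FiniteUpset where
  directed S T :=
    ⟨⟨S.1 ∪ T.1, S.2.1.union T.2.1, fun x hx y h =>
      hx.imp (fun hx => S.2.2 x hx y h) (fun hx => T.2.2 x hx y h)⟩,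
      Set.subset_union_left, Set.subset_union_right⟩

/-- The diagram of the finite upward closed subframes of a Kripke frame. -/
def finiteUpsetFunctor : P.FiniteUpset ⥤ KFrF.{u} where
  obj S := ⟨⟨S.1, fun x y => P.rel x.1 y.1⟩, S.2.1.to_subtype⟩
  map {S T} f := ObjectProperty.homMk
    { toFun x := ⟨x.1, leOfHom f x.2⟩
      stable _ _ h := h
      isOpen y x h := ⟨⟨y.1, S.2.2 x.1 x.2 _ h⟩, h, rfl⟩ }

/-- The inclusions of the finite upward closed subframes of a Kripke frame. -/
def finiteUpsetCocone : Cocone (P.finiteUpsetFunctor ⋙ isFinite.ι) where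
  pt := P
  ι :=
    { app S :=
        { toFun x := x.1
          stable _ _ h := h
          isOpen y x h := ⟨⟨y, S.2.2 x.1 x.2 y h⟩, h, rfl⟩ }
      naturality _ _ _ := rfl }

variable {P}

/-- The finite upward closed set generated by a point of a locally finite frame. -/
def reachableUpset (hP : isLocallyFinite P) (p : P.carrier) : P.FiniteUpset :=
  ⟨P.reachable p, hP p, fun _ hx _ h => reachable_closed hx h⟩

theorem mem_reachableUpset (hP : isLocallyFinite P) (p : P.carrier) :
    p ∈ (reachableUpset hP p).1 :=
  Relation.ReflTransGen.refl

theorem reachableUpset_le (hP : isLocallyFinite P) {p : P.carrier} (S : P.FiniteUpset)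
    (hp : p ∈ S.1) : reachableUpset hP p ≤ S := by
  intro q (hq : Relation.ReflTransGen P.rel p q)
  induction hq with
  | refl => exact hp
  | tail _ h ih => exact S.2.2 _ ih _ h

/-- The value at a point of the map out of a locally finite frame induced by a cocone. -/
def finiteUpsetDesc (hP : isLocallyFinite P) (s : Cocone (P.finiteUpsetFunctor ⋙ isFinite.ι))
    (p : P.carrier) : s.pt.carrier :=
  Hom.toFun (s.ι.app (reachableUpset hP p)) ⟨p, mem_reachableUpset hP p⟩

/-- $R^*(p)$ is the least upset containing $p$, so every stage containing $p$ is compared with it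
directly. -/
theorem finiteUpsetDesc_eq (hP : isLocallyFinite P)
    (s : Cocone (P.finiteUpsetFunctor ⋙ isFinite.ι)) (S : P.FiniteUpset) (p : S.1) :
    finiteUpsetDesc hP s p.1 = Hom.toFun (s.ι.app S) p :=
  (cocone_w _ s (homOfLE (reachableUpset_le hP S p.2)) ⟨p.1, mem_reachableUpset hP p.1⟩).symm

/-- A locally finite frame is the colimit of its finite upward closed subframes. -/
def finiteUpsetCoconeIsColimit (hP : isLocallyFinite P) : IsColimit P.finiteUpsetCocone where
  desc s :=
    { toFun := finiteUpsetDesc hP s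
      stable p q h := by
        rw [finiteUpsetDesc_eq hP s (reachableUpset hP p) ⟨q, Relation.ReflTransGen.single h⟩]
        exact Hom.stable (s.ι.app (reachableUpset hP p)) _ _ h
      isOpen q' p h := by
        obtain ⟨y, hy, e⟩ := Hom.isOpen (s.ι.app (reachableUpset hP p)) _ _ h
        exact ⟨y.1, hy, (finiteUpsetDesc_eq hP s _ y).trans e⟩ }
  fac s S := hom_ext fun p => finiteUpsetDesc_eq hP s S p
  uniq s m hm := hom_ext fun p =>
    congrArg (fun g : (P.finiteUpsetFunctor ⋙ isFinite.ι).obj (reachableUpset hP p) ⟶ s.pt =>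
      Hom.toFun g ⟨p, mem_reachableUpset hP p⟩) (hm (reachableUpset hP p))

end FiniteUpset

/-- A Kripke frame is locally finite if and only if it is a filtered colimit of finite frames. -/
theorem isLocallyFinite_eq_isFilteredColimitOfFinite :
    isLocallyFinite.{u} = isFilteredColimitOfFinite.{u} := by
  ext P
  constructor
  · intro hP
    exact ⟨P.FiniteUpset, inferInstance, inferInstance, P.finiteUpsetFunctor, P.finiteUpsetCocone,
      rfl, ⟨finiteUpsetCoconeIsColimit hP⟩⟩
  · rintro ⟨J, _, _, F, c, rfl, ⟨hc⟩⟩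
    exact isColimit_isLocallyFinite hc fun j =>
      isFinite_le_isLocallyFinite _ (F.obj j).property

/-- The Kripke frame with points `Fin n` and a given relation. -/
def ofFin (r : Σ n : ℕ, Fin n → Fin n → Prop) : KFrF.{u} :=
  ⟨⟨ULift.{u} (Fin r.1), fun x y => r.2 x.down y.down⟩, inferInstanceAs (Finite (ULift _))⟩

/-- A relation-preserving and -reflecting bijection is an isomorphism of frames. -/
def isoOfEquiv {P Q : KFr.{u}} (e : P.carrier ≃ Q.carrier)
    (h : ∀ x y, P.rel x y ↔ Q.rel (e x) (e y)) : P ≅ Q where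
  hom :=
    { toFun := e
      stable x y := (h x y).1
      isOpen y x hxy := ⟨e.symm y, by rwa [h, e.apply_symm_apply], e.apply_symm_apply y⟩ }
  inv :=
    { toFun := e.symm
      stable x y hxy := by rwa [h, e.apply_symm_apply, e.apply_symm_apply]
      isOpen y x hxy := ⟨e y, by rwa [h, e.apply_symm_apply] at hxy, e.symm_apply_apply y⟩ }
  hom_inv_id := hom_ext e.symm_apply_apply
  inv_hom_id := hom_ext e.apply_symm_apply

theorem exists_iso_ofFin (P : KFrF.{u}) : ∃ r, Nonempty (ofFin.{u} r ≅ P) := by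
  have : Finite P.obj.carrier := P.property
  obtain ⟨n, ⟨e⟩⟩ := Finite.exists_equiv_fin P.obj.carrier
  exact ⟨⟨n, fun x y => P.obj.rel (e.symm x) (e.symm y)⟩,
    ⟨ObjectProperty.isoMk _ (isoOfEquiv (Equiv.ulift.trans e.symm) fun _ _ => Iff.rfl)⟩⟩

end KFr

/-- Isomorphism classes are covered by the relations on the sets `Fin n`, which form a small type.
-/
instance KFrF.essentiallySmall : EssentiallySmall.{u} KFrF.{u} := by
  refine (essentiallySmall_iff _).2 ⟨small_of_surjective
    (f := fun r => toSkeleton (KFr.ofFin.{u} r)) fun X => ?_, inferInstance⟩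
  obtain ⟨r, ⟨e⟩⟩ := KFr.exists_iso_ofFin ((fromSkeleton _).obj X)
  exact ⟨r, toSkeleton_eq_iff.2 ⟨e⟩⟩

instance KFrF.isFinitelyPresentable_toLF (P : KFrF.{u}) :
    IsFinitelyPresentable.{u} (KFrF.toLF.{u}.obj P) := by
  have : Finite P.obj.carrier := P.property
  -- Two goals remain: maps into the colimit factor through a stage, and maps to a stage that agree
  -- in the colimit agree later.
  refine isFinitelyPresentable_iff_preservesFilteredColimits.2 ⟨fun J _ _ => ⟨fun {F} => ⟨fun
    {c} hc => ⟨Types.FilteredColimit.isColimitOf' _ _ (fun f => ?_) fun i f g h => ?_⟩⟩⟩⟩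
  · obtain ⟨j, g, hg⟩ := KFr.exists_comp_eq (P := P.obj)
      (isColimitOfPreserves KFr.isLocallyFinite.ι hc) (fun j => (F.obj j).property) f.hom
    exact ⟨j, ObjectProperty.homMk g, ObjectProperty.hom_ext _ hg.symm⟩
  · obtain ⟨k, u, hu⟩ := KFr.exists_comp_map_eq (P := P.obj)
      (isColimitOfPreserves KFr.isLocallyFinite.ι hc) f.hom g.hom
      (congrArg InducedCategory.Hom.hom h)
    exact ⟨k, u, ObjectProperty.hom_ext _ hu⟩

/-! ### Recognizing an Ind-completion -/

namespace CategoryTheory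

universe v u₁ u₂

variable {C : Type u₁} [Category.{v} C] {D : Type u₂} [Category.{v} D] (F : C ⥤ D)

/-- The functor sending `d` to the presheaf of morphisms from objects `F.obj c` to `d`. -/
def restrictedYonedaAlong : D ⥤ Cᵒᵖ ⥤ Type v :=
  yoneda ⋙ (Functor.whiskeringLeft _ _ _).obj F.op

/-- A fully faithful functor followed by its restricted Yoneda functor is the Yoneda embedding. -/
noncomputable def compRestrictedYonedaAlong [F.Full] [F.Faithful] :
    F ⋙ restrictedYonedaAlong F ≅ yoneda :=
  (NatIso.ofComponents (fun c => NatIso.ofComponents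
    (fun c' => ((Functor.FullyFaithful.ofFullyFaithful F).homEquiv (X := c'.unop) (Y := c)).toIso)
    (fun f => by ext g; exact F.map_comp f.unop g))
    (fun f => by ext c' g; exact F.map_comp g f)).symm

theorem restrictedYonedaAlong_preservesColimitsOfShape
    (hF : ∀ c, IsFinitelyPresentable.{v} (F.obj c)) (J : Type v) [SmallCategory J]
    [IsFiltered J] : PreservesColimitsOfShape J (restrictedYonedaAlong F) :=
  preservesColimitsOfShape_of_evaluation _ J fun c =>
    have := hF c.unop
    inferInstanceAs (PreservesColimitsOfShape J (coyoneda.obj (Opposite.op (F.obj c.unop))))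

/-- The objects which are small filtered colimits of objects in the image of `F`. -/
def isFilteredColimitOfImage : ObjectProperty D := fun d =>
  ∃ (J : Type v) (_ : SmallCategory J) (_ : IsFiltered J) (G : J ⥤ C) (c : Cocone (G ⋙ F)),
    c.pt = d ∧ Nonempty (IsColimit c)

variable {F}

theorem restrictedYonedaAlong_faithful (h : ∀ d, isFilteredColimitOfImage F d) :
    (restrictedYonedaAlong F).Faithful where
  map_injective {d _ f g} e := by
    obtain ⟨J, _, _, G, c, rfl, ⟨hc⟩⟩ := h d
    refine hc.hom_ext fun j => ?_
    exact ConcreteCategory.congr_hom (NatTrans.congr_app e (Opposite.op (G.obj j))) (c.ι.app j)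

/-- The values of `α` on the colimit legs form a cocone, hence a morphism. It induces `α` because,
by finite presentability, any `F.obj x ⟶ c.pt` factors through a leg. -/
theorem restrictedYonedaAlong_full (hF : ∀ c, IsFinitelyPresentable.{v} (F.obj c))
    [F.Full] (h : ∀ d, isFilteredColimitOfImage F d) :
    (restrictedYonedaAlong F).Full where
  map_surjective {d d'} α := by
    obtain ⟨J, _, _, G, c, rfl, ⟨hc⟩⟩ := h d
    have nat {x y : C} (f : x ⟶ y) (g : F.obj y ⟶ c.pt) :
        (show F.obj x ⟶ d' from α.app (Opposite.op x) (F.map f ≫ g)) =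
          F.map f ≫ (show F.obj y ⟶ d' from α.app (Opposite.op y) g) :=
      ConcreteCategory.congr_hom (α.naturality f.op) g
    let s : Cocone (G ⋙ F) :=
      { pt := d'
        ι :=
          { app j := α.app (Opposite.op (G.obj j)) (c.ι.app j)
            naturality i j u := by
              refine (nat (G.map u) (c.ι.app j)).symm.trans ?_
              have := c.w u
              simp only [Functor.comp_map] at this
              rw [this]
              exact (Category.comp_id _).symm } }
    refine ⟨hc.desc s, ?_⟩
    ext x (f : F.obj x.unop ⟶ c.pt)
    have := hF x.unop
    obtain ⟨j, p, rfl⟩ := IsFinitelyPresentable.exists_hom_of_isColimit hc f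
    obtain ⟨p, rfl⟩ := F.map_surjective p
    refine Eq.trans ?_ (nat p (c.ι.app j)).symm
    change (F.map p ≫ c.ι.app j) ≫ hc.desc s = _
    rw [Category.assoc, hc.fac]

variable [F.Full] [F.Faithful]

theorem isIndObject_restrictedYonedaAlong (hF : ∀ c, IsFinitelyPresentable.{v} (F.obj c))
    {d : D} (h : isFilteredColimitOfImage F d) :
    IsIndObject ((restrictedYonedaAlong F).obj d) := by
  obtain ⟨J, _, _, G, c, rfl, ⟨hc⟩⟩ := h
  have := restrictedYonedaAlong_preservesColimitsOfShape F hF J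
  let e : G ⋙ yoneda ≅ (G ⋙ F) ⋙ restrictedYonedaAlong F :=
    Functor.isoWhiskerLeft G (compRestrictedYonedaAlong F).symm
  exact ⟨⟨IndObjectPresentation.ofCocone
    ((Cocone.precompose e.hom).obj ((restrictedYonedaAlong F).mapCocone c))
    ((IsColimit.precomposeHomEquiv e _).symm (isColimitOfPreserves _ hc))⟩⟩

/-- The diagram presenting `A` has a colimit in `D`, and restricted Yoneda preserves it. -/
theorem exists_iso_restrictedYonedaAlong (hF : ∀ c, IsFinitelyPresentable.{v} (F.obj c))
    [HasFilteredColimits D] {A : Cᵒᵖ ⥤ Type v} (hA : IsIndObject A) :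
    ∃ d, Nonempty ((restrictedYonedaAlong F).obj d ≅ A) := by
  obtain ⟨⟨P⟩⟩ := hA
  have := restrictedYonedaAlong_preservesColimitsOfShape F hF P.I
  have := HasFilteredColimitsOfSize.HasColimitsOfShape (C := D) P.I
  let e : P.F ⋙ yoneda ≅ (P.F ⋙ F) ⋙ restrictedYonedaAlong F :=
    Functor.isoWhiskerLeft P.F (compRestrictedYonedaAlong F).symm
  exact ⟨colimit (P.F ⋙ F), ⟨IsColimit.coconePointsIsoOfNatIso
    (isColimitOfPreserves (restrictedYonedaAlong F) (colimit.isColimit (P.F ⋙ F)))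
    P.coconeIsColimit e.symm⟩⟩

/-- If `F : C ⥤ D` is fully faithful with finitely presentable values, `D` has filtered colimits and
every object of `D` is a filtered colimit of values of `F`, then `D` is the Ind-completion
of `C`. -/
theorem exists_ind_equivalence (hF : ∀ c, IsFinitelyPresentable.{v} (F.obj c))
    [HasFilteredColimits D] (h : ∀ d, isFilteredColimitOfImage F d) :
    ∃ e : Ind C ≌ D, Nonempty (Ind.yoneda ⋙ e.functor ≅ F) := by
  let G : D ⥤ ObjectProperty.FullSubcategory (IsIndObject (C := C)) :=
    ObjectProperty.lift _ (restrictedYonedaAlong F)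
      fun d => isIndObject_restrictedYonedaAlong hF (h d)
  have := restrictedYonedaAlong_faithful h
  have := restrictedYonedaAlong_full hF h
  have : G.Full := inferInstanceAs (ObjectProperty.lift _ _ _).Full
  have : G.Faithful := inferInstanceAs (ObjectProperty.lift _ _ _).Faithful
  have : G.EssSurj := ⟨fun A => by
    obtain ⟨d, ⟨e⟩⟩ := exists_iso_restrictedYonedaAlong (F := F) hF A.property
    exact ⟨d, ⟨ObjectProperty.isoMk _ e⟩⟩⟩
  have : G.IsEquivalence := { }
  let i : F ⋙ G ≅ ObjectProperty.lift _ yoneda isIndObject_yoneda :=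
    -- Composing with a fully faithful inclusion is fully faithful, so the isomorphism of
    -- presheaf-valued functors lifts.
    ((ObjectProperty.fullyFaithfulι _).whiskeringRight C).preimageIso (compRestrictedYonedaAlong F)
  let I := ObjectProperty.lift (IsIndObject (C := C)) yoneda isIndObject_yoneda
  exact ⟨(Ind.equivalence C).trans G.asEquivalence.symm, ⟨calc
    Ind.yoneda ⋙ (Ind.equivalence C).functor ⋙ G.inv
      ≅ I ⋙ ((Ind.equivalence C).inverse ⋙ (Ind.equivalence C).functor) ⋙ G.inv := Iso.refl _
    _ ≅ I ⋙ 𝟭 _ ⋙ G.inv := Functor.isoWhiskerLeft I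
      (Functor.isoWhiskerRight (Ind.equivalence C).counitIso G.inv)
    _ ≅ (F ⋙ G) ⋙ G.inv := Functor.isoWhiskerRight i.symm G.inv
    _ ≅ F ⋙ 𝟭 _ := Functor.isoWhiskerLeft F G.asEquivalence.unitIso.symm
    _ ≅ F := F.rightUnitor⟩⟩

end CategoryTheory

theorem KFrLF.isFilteredColimitOfImage_toLF (P : KFrLF.{u}) :
    isFilteredColimitOfImage KFrF.toLF.{u} P := by
  let c : Cocone (P.obj.finiteUpsetFunctor ⋙ KFrF.toLF) :=
    { pt := P
      ι :=
        { app S := ObjectProperty.homMk (P.obj.finiteUpsetCocone.ι.app S)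
          naturality _ _ f :=
            ObjectProperty.hom_ext _ (P.obj.finiteUpsetCocone.ι.naturality f) } }
  exact ⟨P.obj.FiniteUpset, inferInstance, inferInstance, P.obj.finiteUpsetFunctor, c, rfl,
    -- The inclusion is fully faithful, so it reflects the colimit from `KFr`.
    ⟨isColimitOfReflects KFr.isLocallyFinite.ι
      (KFr.finiteUpsetCoconeIsColimit P.property : IsColimit P.obj.finiteUpsetCocone)⟩⟩

theorem mainTheorem4 :
    EssentiallySmall.{u} KFrF.{u} ∧
    (∃ e : Ind KFrF.{u} ≌ KFrLF.{u}, Nonempty (Ind.yoneda ⋙ e.functor ≅ KFrF.toLF.{u})) ∧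
    HasFilteredColimits KFrLF.{u} ∧
    (∀ P : KFrF.{u}, IsFinitelyPresentable.{u} (KFrF.toLF.{u}.obj P)) ∧
    KFr.isLocallyFinite.{u} = KFr.isFilteredColimitOfFinite.{u} :=
  ⟨inferInstance,
    exists_ind_equivalence KFrF.isFinitelyPresentable_toLF KFrLF.isFilteredColimitOfImage_toLF,
    inferInstance, inferInstance, KFr.isLocallyFinite_eq_isFilteredColimitOfFinite⟩
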